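/- Consider a synchronous anonymous network of $n\ge 1$ processors with classical broadcast communication, whose processors share a pure state $|\psi\rangle\in(\mathbb{C}^2)^{\otimes n}$ (a unit vector), one qubit per processor. All processors start in the same classical state and execute the same local program on their qubit and finitely many ancilla qubits initialized to $|0\rangle$: in each round a processor applies a unitary and a projective measurement to its own quantum memory and may broadcast a message, until it terminates with a bit value. The network is anonymous if moreover $|\psi\rangle\langle\psi|$ is invariant under all permutations of the $n$ qubits. The protocol is purely quantum (no classical post-processing) if the quantum operations of a processor may be controlled only by its own earlier measurement results, not by messages received from others, and the value with which it terminates is the result of its last measurement. It is a totally correct distributed consensus protocol for $|\psi\rangle$ if every computation (of positive probability) reaches a configuration in which all processors have terminated, in every reachable configuration of this kind all processors hold the same bit, and this bit is $0$ or $1$ with probability $\tfrac12$ each. Theorem. For every unit vector $|\psi\rangle\in(\mathbb{C}^2)^{\otimes n}$ the following are equivalent: (i) $|\psi\rangle\langle\psi|$ is invariant under all permutations of the qubits, and there is a purely quantum protocol that is a totally correct distributed consensus protocol for $|\psi\rangle$; (ii) $|\psi\rangle$ is the GHZ-state up to identical local unitaries, that is, $|\psi\rangle=U^{\otimes n}\,\frac{1}{\sqrt2}\left(|0\rangle^{\otimes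 n}+|1\rangle^{\otimes n}\right)$ for some unitary $U$ on $\mathbb{C}^2$. Moreover, for the GHZ-state itself the one-round protocol in which every processor simply measures its qubit in the computational basis and terminates with the result is purely quantum and a totally correct distributed consensus protocol. -/

import Mathlib

open scoped Matrix

noncomputable section

/-! ### Vectors and operators on tensor powers, in coordinates -/

/-- A vector of `H^{⊗ n}`, where `H` has the orthonormal basis `B`: its coordinates in the product
basis `Fin n → B`. For `B = Fin 2` this is a (not necessarily normalized) state of `n` qubits. -/
abbrev TensorVec (n : ℕ) (B : Type) : Type := (Fin n → B) → ℂ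

/-- The squared Euclidean norm `⟨φ, φ⟩`. -/
def sqNorm {n : ℕ} {B : Type} [Fintype B] (φ : TensorVec n B) : ℝ := ∑ x, ‖φ x‖ ^ 2

/-- The operator `A 0 ⊗ A 1 ⊗ ⋯ ⊗ A (n-1)` on `H^{⊗ n}`. -/
def tensorOp {n : ℕ} {B : Type} (A : Fin n → Matrix B B ℂ) :
    Matrix (Fin n → B) (Fin n → B) ℂ :=
  Matrix.of fun x y => ∏ i, A i (x i) (y i)

/-- The density matrix `|ψ⟩⟨ψ|`. -/
def density {n : ℕ} {B : Type} (ψ : TensorVec n B) : Matrix (Fin n → B) (Fin n → B) ℂ :=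
  Matrix.of fun x y => ψ x * star (ψ y)

/-- The state `|ψ⟩⟨ψ|` is anonymous: it is invariant under every permutation of the subspaces that
belong to the processors. (The vector `ψ` itself may pick up a phase.) -/
def IsAnonymous {n : ℕ} {B : Type} (ψ : TensorVec n B) : Prop :=
  ∀ σ : Equiv.Perm (Fin n),
    (density ψ).submatrix (fun x => x ∘ σ) (fun x => x ∘ σ) = density ψ

/-- The normalized state `(|0⋯0⟩ + |1⋯1⟩) / √2` of `n` qubits (for `n ≥ 1`). -/
def ghz (n : ℕ) : TensorVec n (Fin 2) := fun x =>
  (((if x = fun _ => 0 then 1 else 0) + (if x = fun _ => 1 then 1 else 0) : ℂ)) /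
    ((Real.sqrt 2 : ℝ) : ℂ)

/-! ### Protocols -/

/-- Complete sets of orthogonal projectors `P_0, …, P_{J-1}` on the space with basis `B`. -/
structure ProjMeasurement (B : Type) [Fintype B] [DecidableEq B] (J : ℕ) where
  proj : Fin J → Matrix B B ℂ
  isHermitian : ∀ j, (proj j).IsHermitian
  mul_proj : ∀ j j', proj j * proj j' = if j = j' then proj j else 0
  sum_proj : ∑ j, proj j = 1

/-- The basis of a processor's quantum memory: the qubit that it owns initially (first component)
and `m` ancilla qubits. -/
abbrev LocalBasis (m : ℕ) : Type := Fin 2 × (Fin m → Fin 2)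

/-- The local program that all processors of a synchronous anonymous network with classical
broadcasts execute. In each round a processor receives the multiset of the messages that the other
processors broadcast in the previous round, applies a unitary and a projective measurement to its
own quantum memory, and then, in a classical post-processing stage, updates its classical state and
possibly broadcasts a message. -/
structure Protocol where
  /-- the number of ancilla qubits of a processor, initially in the state `|0⟩` -/
  m : ℕ
  /-- a bound for the number of results of a local measurement; unused results get projector `0` -/
  J : ℕ
  /-- local classical states -/
  S : Type
  /-- classical messages -/
  M : Type
  finite_S : Finite S
  finite_M : Finite M
  /-- the initial classical state -/
  init : S
  /-- `none` while the processor is running, `some b` once it has terminated with value `b` -/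
  result : S → Option (Fin 2)
  /-- the unitary applied, given the classical state and the received messages -/
  unitary : S → Multiset M → Matrix.unitaryGroup (LocalBasis m) ℂ
  /-- the measurement made after it -/
  meas : S → Multiset M → ProjMeasurement (LocalBasis m) J
  /-- classical post-processing: from the classical state, the received messages and the
  measurement result to the new classical state and the message to be broadcast, if any -/
  post : S → Multiset M → Fin J → S × Option M

namespace Protocol

variable (P : Protocol)

/-- A protocol is purely quantum if it has no classical post-processing: the messages of other
processors influence neither the quantum operations nor the local state (so that the only thing a
later operation can be controlled by are the processor's own earlier measurement results), and the
value with which a processor terminates is the very result of its last measurement. -/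
structure PurelyQuantum : Prop where
  unitary_eq : ∀ s r r', P.unitary s r = P.unitary s r'
  meas_eq : ∀ s r r', P.meas s r = P.meas s r'
  post_eq : ∀ s r r' j, (P.post s r j).1 = (P.post s r' j).1
  result_eq : ∀ s r j b, P.result s = none → P.result (P.post s r j).1 = some b →
    (j : ℕ) = (b : ℕ)

/-- What a processor observes in a round: a measurement result, or `none` if it has terminated
and does nothing. -/
abbrev Obs : Type := Option (Fin P.J)

/-- The operator by which a processor acts on its quantum memory when it observes `o`. -/
def kraus (s : P.S) (r : Multiset P.M) (o : P.Obs) :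
    Matrix (LocalBasis P.m) (LocalBasis P.m) ℂ :=
  match P.result s, o with
  | none, some j => (P.meas s r).proj j * (P.unitary s r : Matrix _ _ ℂ)
  | none, none => 0
  | some _, none => 1
  | some _, some _ => 0

/-- The new classical state and the broadcast of a processor that observes `o`. -/
def update (s : P.S) (r : Multiset P.M) (o : P.Obs) : P.S × Option P.M :=
  match o with
  | none => (s, none)
  | some j => P.post s r j

/-- Configurations of a network of `n` processors: the local classical states, the messages
broadcast in the previous round, and the network quantum state. The latter is not normalized: its
squared norm is the probability of the sequence of observations that led to it. -/
structure Config (n : ℕ) where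
  state : Fin n → P.S
  sent : Fin n → Option P.M
  vec : TensorVec n (LocalBasis P.m)

variable {n : ℕ}

/-- The initial configuration for the shared `n`-qubit state `ψ`. -/
def initial (ψ : TensorVec n (Fin 2)) : P.Config n where
  state := fun _ => P.init
  sent := fun _ => none
  vec := fun x => ψ (fun i => (x i).1) * ∏ i, if (x i).2 = 0 then 1 else 0

variable {P}

/-- The messages that processor `i` receives: it does not see who sent them. -/
def Config.received (c : P.Config n) (i : Fin n) : Multiset P.M :=
  (Finset.univ.erase i).val.filterMap c.sent

/-- One synchronous round in which the processors observe `o`. -/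
def Config.step (c : P.Config n) (o : Fin n → P.Obs) : P.Config n where
  state := fun i => (P.update (c.state i) (c.received i) (o i)).1
  sent := fun i => (P.update (c.state i) (c.received i) (o i)).2
  vec := tensorOp (fun i => P.kraus (c.state i) (c.received i) (o i)) *ᵥ c.vec

/-- The configuration is terminal: every processor has terminated. -/
def Config.IsTerminal (c : P.Config n) : Prop := ∀ i, (P.result (c.state i)).isSome

/-- All processors have terminated with the value `b`. -/
def Config.Agree (c : P.Config n) (b : Fin 2) : Prop := ∀ i, P.result (c.state i) = some b

variable (P)

/-- The configuration after a sequence of rounds with given observations. It is reached with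
positive probability if and only if its quantum state is nonzero. -/
def run (ψ : TensorVec n (Fin 2)) (h : List (Fin n → P.Obs)) : P.Config n :=
  h.foldl Config.step (P.initial ψ)

/-- Every (infinite, possible) computation reaches a terminal configuration. -/
def Terminating (ψ : TensorVec n (Fin 2)) : Prop :=
  ∀ ω : ℕ → (Fin n → P.Obs),
    (∀ t, (P.run ψ ((List.range t).map ω)).vec ≠ 0) →
      ∃ t, (P.run ψ ((List.range t).map ω)).IsTerminal

open Classical in
/-- The probability that after `t` rounds all processors have terminated with the value `b`. -/
def probAgree (ψ : TensorVec n (Fin 2)) (b : Fin 2) (t : ℕ) : ℝ :=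
  ∑ h : Fin t → (Fin n → P.Obs),
    if (P.run ψ (List.ofFn h)).Agree b then sqNorm (P.run ψ (List.ofFn h)).vec else 0

/-- The goal of distributed consensus is achieved in all reachable terminal configurations: all
processors hold the same bit, which is `0` or `1` with equal probability `1/2`. -/
def PartiallyCorrect (ψ : TensorVec n (Fin 2)) : Prop :=
  (∀ h : List (Fin n → P.Obs), (P.run ψ h).vec ≠ 0 → (P.run ψ h).IsTerminal →
    ∃ b, (P.run ψ h).Agree b) ∧
  ∀ b : Fin 2, Filter.Tendsto (P.probAgree ψ b) Filter.atTop (nhds (1 / 2))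

/-- Executed by `n` processors that share `ψ`, the protocol is a totally correct distributed
consensus protocol. -/
def TotallyCorrect (ψ : TensorVec n (Fin 2)) : Prop :=
  P.Terminating ψ ∧ P.PartiallyCorrect ψ

end Protocol

/-- The measurement of a processor's initial qubit in the computational basis, without ancillas. -/
def measureQubit : ProjMeasurement (LocalBasis 0) 2 where
  proj := fun j => Matrix.diagonal fun x => if x.1 = j then 1 else 0
  isHermitian := by
    intro j
    rw [Matrix.isHermitian_diagonal_iff]
    intro x
    split_ifs <;> simp [IsSelfAdjoint]
  mul_proj := by
    intro j j'
    by_cases h : j = j'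
    · subst h
      simp [Matrix.diagonal_mul_diagonal]
    · rw [if_neg h, Matrix.diagonal_mul_diagonal, ← Matrix.diagonal_zero]
      congr 1
      funext x
      by_cases hx : x.1 = j
      · have : x.1 ≠ j' := fun h' => h (hx.symm.trans h')
        simp [this]
      · simp [hx]
  sum_proj := by
    ext x y
    by_cases h : x = y
    · subst h
      simp [Matrix.sum_apply]
    · simp [Matrix.sum_apply, h]

/-- The one-round protocol in which every processor measures its qubit in the computational basis
and terminates with the result; no message is sent. -/
def measureProtocol : Protocol where
  m := 0
  J := 2
  S := Option (Fin 2)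
  M := Empty
  finite_S := inferInstance
  finite_M := inferInstance
  init := none
  result := id
  unitary := fun _ _ => 1
  meas := fun _ _ => measureQubit
  post := fun _ _ j => (some j, none)

end

/-! Without classical post-processing, messages influence neither the operators nor the local
states. A joint history therefore acts on `ψ` as a tensor product of operators, each depending only
on one processor's own history (`PurelyQuantum.run_vec`). All processors run the same program, so
the probability that all have returned `b` by time `t` is `⟨ψ, E^{⊗n} ψ⟩` for a single effect `E` on
one qubit (`PurelyQuantum.probAgree_eq`).

Let `E_t` be the effect of having returned `0`. The weight of `E_t^{⊗n}` tends to 1/2, and that of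
`(1 - E_t)^{⊗n}` is at least the probability that all return `1`, which also tends to 1/2. Since
these are only limits, write `E_t = W diag(d) Wᴴ` and use compactness to obtain a limiting basis `W`
and weights `d` (`exists_limit_effect`). In that basis, with coordinates `c` of the state, `∑ |c x|²
(∏ d(x i) + ∏ (1 - d(x i))) ≥ 1`. For `n ≥ 2` each bracket is at most 1, with equality only if all
`d(x i)` are 0 or all are 1 (`sharp_of_weight`). Both weights are nonzero, so `d` separates the two
basis vectors. Hence `c` lives on the two constant strings with weight 1/2 each, and the phases are
absorbed by a diagonal unitary (`exists_unitary_of_weights`). For `n = 1` every state is a unitary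
image of the GHZ state.

Conversely, for `ψ = U^{⊗n} GHZ` each processor applies `Uᴴ` and measures. `MeasuresOnce` handles
this protocol and the plain measurement (`U = 1`) together. -/

/-! ### Tensor products of matrices -/

section Tensor

variable {n : ℕ} {B C D H : Type}

/-- The linear map `A 0 ⊗ ⋯ ⊗ A (n-1)` between tensor powers of possibly different spaces. -/
def tensorMap (A : Fin n → Matrix B C ℂ) : Matrix (Fin n → B) (Fin n → C) ℂ :=
  Matrix.of fun x y => ∏ i, A i (x i) (y i)

theorem tensorOp_eq_tensorMap (A : Fin n → Matrix B B ℂ) : tensorOp A = tensorMap A := rfl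

theorem tensorMap_mul [Fintype C] (A : Fin n → Matrix B C ℂ) (A' : Fin n → Matrix C D ℂ) :
    tensorMap A * tensorMap A' = tensorMap fun i => A i * A' i := by
  ext x y
  simp only [tensorMap, Matrix.mul_apply, Matrix.of_apply, ← Finset.prod_mul_distrib]
  rw [Finset.prod_univ_sum]
  simp

theorem tensorMap_conjTranspose (A : Fin n → Matrix B C ℂ) :
    (tensorMap A)ᴴ = tensorMap fun i => (A i)ᴴ := by
  ext x y
  simp [tensorMap, Matrix.conjTranspose_apply]

theorem tensorMap_diagonal [DecidableEq B] (d : Fin n → B → ℂ) :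
    tensorMap (fun i => Matrix.diagonal (d i)) = Matrix.diagonal fun x => ∏ i, d i (x i) := by
  ext x y
  simp only [tensorMap, Matrix.of_apply, Matrix.diagonal_apply]
  split_ifs with h
  · subst h
    simp
  · obtain ⟨i, hi⟩ := Function.ne_iff.mp h
    exact Finset.prod_eq_zero (Finset.mem_univ i) (if_neg hi)

theorem tensorMap_one [DecidableEq B] :
    tensorMap (fun _ : Fin n => (1 : Matrix B B ℂ)) = 1 := by
  simp only [← Matrix.diagonal_one]
  rw [tensorMap_diagonal]
  simp

theorem tensorMap_eq_zero {A : Fin n → Matrix B C ℂ} {i : Fin n} (h : A i = 0) :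
    tensorMap A = 0 := by
  ext x y
  exact Finset.prod_eq_zero (Finset.mem_univ i) (by simp [h])

theorem sum_tensorMap [Fintype H] (K : Fin n → H → Matrix B C ℂ) :
    ∑ g : Fin n → H, tensorMap (fun i => K i (g i)) = tensorMap fun i => ∑ h, K i h := by
  ext x y
  simp only [tensorMap, Matrix.sum_apply, Matrix.of_apply]
  rw [Finset.prod_univ_sum]
  simp

theorem sqNorm_eq_dotProduct [Fintype B] (φ : TensorVec n B) :
    (sqNorm φ : ℂ) = star φ ⬝ᵥ φ := by
  simp [sqNorm, dotProduct, Complex.conj_mul']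

theorem sqNorm_nonneg [Fintype B] (φ : TensorVec n B) : 0 ≤ sqNorm φ :=
  Finset.sum_nonneg fun _ _ => by positivity

theorem sqNorm_tensorMap_mulVec [Fintype B] [Fintype C] (A : Fin n → Matrix B C ℂ)
    (φ : TensorVec n C) : (sqNorm (tensorMap A *ᵥ φ) : ℂ) =
      star φ ⬝ᵥ (tensorMap (fun i => (A i)ᴴ * A i) *ᵥ φ) := by
  rw [sqNorm_eq_dotProduct, Matrix.star_mulVec, ← Matrix.dotProduct_mulVec,
    Matrix.mulVec_mulVec, tensorMap_conjTranspose, tensorMap_mul]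

/-- The value `⟨φ, A^{⊗ n} φ⟩`. -/
def tensorForm [Fintype B] (φ : TensorVec n B) (A : Matrix B B ℂ) : ℂ :=
  star φ ⬝ᵥ (tensorMap (fun _ => A) *ᵥ φ)

theorem continuous_tensorForm [Fintype B] (φ : TensorVec n B) : Continuous (tensorForm φ) := by
  unfold tensorForm tensorMap dotProduct Matrix.mulVec dotProduct
  simp only [Matrix.of_apply]
  fun_prop

theorem tensorForm_conj [Fintype B] (φ : TensorVec n B) (W A : Matrix B B ℂ) :
    tensorForm φ (W * A * Wᴴ) = tensorForm (tensorMap (fun _ => Wᴴ) *ᵥ φ) A := by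
  unfold tensorForm
  rw [Matrix.star_mulVec, ← Matrix.dotProduct_mulVec, Matrix.mulVec_mulVec, Matrix.mulVec_mulVec,
    tensorMap_conjTranspose, tensorMap_mul, tensorMap_mul]
  simp [mul_assoc]

theorem tensorForm_diagonal [Fintype B] [DecidableEq B] (φ : TensorVec n B) (d : B → ℝ) :
    tensorForm φ (Matrix.diagonal fun k => (d k : ℂ)) =
      ((∑ x, ‖φ x‖ ^ 2 * ∏ i, d (x i) : ℝ) : ℂ) := by
  unfold tensorForm
  rw [tensorMap_diagonal]
  simp only [dotProduct, Matrix.mulVec_diagonal, Pi.star_apply, RCLike.star_def]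
  push_cast
  refine Finset.sum_congr rfl fun x _ => ?_
  rw [← Complex.conj_mul']
  ring

/-- The Born rule for a condition imposed on every processor separately: expanding a product of sums
turns the sum over joint histories into the tensor power of one local effect. -/
theorem sum_sqNorm_tensorMap [Fintype B] [Fintype C] [Fintype H] (K : H → Matrix B C ℂ)
    (p : H → Prop) [DecidablePred p] (φ : TensorVec n C) :
    ((∑ g : Fin n → H, if ∀ i, p (g i) then sqNorm (tensorMap (fun i => K (g i)) *ᵥ φ) else 0 : ℝ)
      : ℂ) = tensorForm φ (∑ h, if p h then (K h)ᴴ * K h else 0) := by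
  unfold tensorForm
  rw [← sum_tensorMap, Matrix.sum_mulVec, dotProduct_sum]
  push_cast
  refine Finset.sum_congr rfl fun g _ => ?_
  split_ifs with h
  · rw [sqNorm_tensorMap_mulVec]
    simp [h]
  · push Not at h
    obtain ⟨i, hi⟩ := h
    rw [tensorMap_eq_zero (i := i) (if_neg hi)]
    simp

end Tensor

/-! ### States with two complementary tensor-power effects of total weight one -/

section Effects

open scoped ComplexOrder

variable {n : ℕ} {B : Type} [Fintype B] [DecidableEq B]

theorem exists_unitary_diagonal {E : Matrix B B ℂ} (hE : E.PosSemidef)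
    (hE' : (1 - E).PosSemidef) : ∃ W ∈ Matrix.unitaryGroup B ℂ, ∃ d ∈ Set.Icc (0 : B → ℝ) 1,
      E = W * Matrix.diagonal (fun k => (d k : ℂ)) * Wᴴ := by
  have hs : E = (hE.1.eigenvectorUnitary : Matrix B B ℂ) *
      Matrix.diagonal (fun k => (hE.1.eigenvalues k : ℂ)) *
        (hE.1.eigenvectorUnitary : Matrix B B ℂ)ᴴ := hE.1.spectral_theorem
  have hW := hE.1.eigenvectorUnitary.2
  generalize (hE.1.eigenvectorUnitary : Matrix B B ℂ) = W at hs hW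
  refine ⟨W, hW, hE.1.eigenvalues, ⟨fun k => hE.eigenvalues_nonneg k, fun k => ?_⟩, hs⟩
  have h1 : Wᴴ * W = 1 := (Matrix.mem_unitaryGroup_iff').mp hW
  have h2 := hE'.conjTranspose_mul_mul_same W
  have h3 : Wᴴ * (1 - E) * W = Matrix.diagonal (fun k => (1 - hE.1.eigenvalues k : ℂ)) := by
    have h4 : Wᴴ * E * W = Matrix.diagonal (fun k => (hE.1.eigenvalues k : ℂ)) := by
      conv_lhs => rw [hs]
      calc _ = (Wᴴ * W) * Matrix.diagonal (fun k => (hE.1.eigenvalues k : ℂ)) * (Wᴴ * W) := by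
            simp only [mul_assoc]
        _ = _ := by rw [h1]; simp
    rw [mul_sub, sub_mul, mul_one, h1, h4, ← Matrix.diagonal_one, Matrix.diagonal_sub]
  rw [h3, Matrix.posSemidef_diagonal_iff] at h2
  have h5 := h2 k
  rw [sub_nonneg] at h5
  exact_mod_cast h5

theorem isCompact_unitaryGroup :
    IsCompact {W : Matrix B B ℂ | W ∈ Matrix.unitaryGroup B ℂ} := by
  have hK : IsCompact (Set.univ.pi fun _ : B => Set.univ.pi fun _ : B =>
      Metric.closedBall (0 : ℂ) 1) :=
    isCompact_univ_pi fun _ => isCompact_univ_pi fun _ => isCompact_closedBall _ _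
  refine hK.of_isClosed_subset ?_ fun W hW i _ j _ => ?_
  · simp only [Matrix.mem_unitaryGroup_iff]
    refine isClosed_eq ?_ continuous_const
    exact continuous_id.matrix_mul (continuous_id.matrix_conjTranspose)
  · simpa using entry_norm_bound_of_unitary hW i j

theorem tensorForm_unitary_conj (φ : TensorVec n B) (W : Matrix B B ℂ) (d : B → ℝ) :
    (tensorForm φ (W * Matrix.diagonal (fun k => (d k : ℂ)) * Wᴴ)).re =
      ∑ x, ‖(tensorMap (fun _ => Wᴴ) *ᵥ φ) x‖ ^ 2 * ∏ i, d (x i) := by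
  rw [tensorForm_conj, tensorForm_diagonal, Complex.ofReal_re]

theorem sqNorm_unitary_mulVec (φ : TensorVec n B) {W : Matrix B B ℂ}
    (hW : W * Wᴴ = 1) : sqNorm (tensorMap (fun _ => Wᴴ) *ᵥ φ) = sqNorm φ := by
  have h : (sqNorm (tensorMap (fun _ => Wᴴ) *ᵥ φ) : ℂ) = sqNorm φ := by
    rw [sqNorm_tensorMap_mulVec, sqNorm_eq_dotProduct]
    simp only [Matrix.conjTranspose_conjTranspose, hW, tensorMap_one, Matrix.one_mulVec]
  exact_mod_cast h

/-- A limit of effects can be diagonalized in some orthonormal basis. -/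
theorem exists_limit_effect (φ : TensorVec n B) (E : ℕ → Matrix B B ℂ)
    (hE : ∀ t, (E t).PosSemidef) (hE' : ∀ t, (1 - E t).PosSemidef) {a b : ℝ} {v : ℕ → ℝ}
    (h0 : Filter.Tendsto (fun t => (tensorForm φ (E t)).re) Filter.atTop (nhds a))
    (h1 : Filter.Tendsto v Filter.atTop (nhds b))
    (hv : ∀ t, v t ≤ (tensorForm φ (1 - E t)).re) :
    ∃ W ∈ Matrix.unitaryGroup B ℂ, ∃ d ∈ Set.Icc (0 : B → ℝ) 1,
      ∑ x, ‖(tensorMap (fun _ => Wᴴ) *ᵥ φ) x‖ ^ 2 * ∏ i, d (x i) = a ∧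
      b ≤ ∑ x, ‖(tensorMap (fun _ => Wᴴ) *ᵥ φ) x‖ ^ 2 * ∏ i, (1 - d (x i)) := by
  choose W hW d hd hEd using fun t => exists_unitary_diagonal (hE t) (hE' t)
  have : FirstCountableTopology (Matrix B B ℂ) :=
    inferInstanceAs (FirstCountableTopology (B → B → ℂ))
  have hK := (isCompact_unitaryGroup (B := B)).prod (isCompact_Icc (a := (0 : B → ℝ)) (b := 1))
  -- Bases and eigenvalues are extracted jointly, so along the subsequence the diagonalizations
  -- themselves converge.
  obtain ⟨⟨W₀, d₀⟩, ⟨hW₀, hd₀⟩, s, hs, hlim⟩ := hK.tendsto_subseq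
    (x := fun t => (W t, d t)) fun t => ⟨hW t, hd t⟩
  -- Used with `g = id` for the effect and `g r = 1 - r` for its complement, which the same unitary
  -- diagonalizes.
  have hcont : ∀ g : ℝ → ℝ, Continuous g → Continuous fun p : Matrix B B ℂ × (B → ℝ) =>
      (tensorForm φ (p.1 * Matrix.diagonal (fun k => ((g (p.2 k) : ℝ) : ℂ)) * p.1ᴴ)).re := by
    intro g hg
    refine Complex.continuous_re.comp ((continuous_tensorForm φ).comp ?_)
    refine (continuous_fst.matrix_mul (Continuous.matrix_diagonal ?_)).matrix_mul
      continuous_fst.matrix_conjTranspose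
    fun_prop
  have hE1 : ∀ t, 1 - E t = W t * Matrix.diagonal (fun k => ((1 - d t k : ℝ) : ℂ)) * (W t)ᴴ := by
    intro t
    have hd1 : Matrix.diagonal (fun k => ((1 - d t k : ℝ) : ℂ)) =
        1 - Matrix.diagonal (fun k => (d t k : ℂ)) := by
      rw [← Matrix.diagonal_one, Matrix.diagonal_sub]
      simp
    rw [hd1, mul_sub, sub_mul, ← hEd, mul_one]
    congr 1
    exact ((Matrix.mem_unitaryGroup_iff).mp (hW t)).symm
  refine ⟨W₀, hW₀, d₀, hd₀, ?_, ?_⟩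
  · rw [← tensorForm_unitary_conj]
    refine tendsto_nhds_unique ?_ (h0.comp hs.tendsto_atTop)
    have := ((hcont id continuous_id).tendsto (W₀, d₀)).comp hlim
    refine this.congr fun t => ?_
    simp only [Function.comp_apply, id, ← hEd]
  · rw [← tensorForm_unitary_conj (d := fun k => 1 - d₀ k)]
    refine le_of_tendsto_of_tendsto' (h1.comp hs.tendsto_atTop)
      (((hcont (fun r => 1 - r) (by fun_prop)).tendsto (W₀, d₀)).comp hlim) fun t => ?_
    simp only [Function.comp_apply, ← hE1]
    exact hv _

/-- Dropping factors from `[0, 1]` only increases a product. Keeping two of them is what makes the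
bound rigid; one factor would only give `f i + (1 - f i) = 1`. -/
theorem prod_add_prod_one_sub_le {f : Fin n → ℝ} (h0 : ∀ i, 0 ≤ f i) (h1 : ∀ i, f i ≤ 1)
    {i j : Fin n} (hij : i ≠ j) :
    ∏ k, f k + ∏ k, (1 - f k) ≤ f i * f j + (1 - f i) * (1 - f j) := by
  have key : ∀ g : Fin n → ℝ, (∀ k, 0 ≤ g k) → (∀ k, g k ≤ 1) → ∏ k, g k ≤ g i * g j := by
    intro g hg0 hg1
    rw [← Finset.prod_pair hij]
    exact Finset.prod_le_prod_of_subset_of_le_one (Finset.subset_univ _)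
      (fun k _ => hg0 k) fun k _ _ => hg1 k
  exact add_le_add (key f h0 h1) (key (fun k => 1 - f k) (fun k => by linarith [h1 k])
    fun k => by linarith [h0 k])

omit [DecidableEq B] in
/-- If the product effects of `d` and of `1 - d` have total weight one on `c`, then `d` takes the
same value, `0` or `1`, on all components of a basis state that occurs in `c`. -/
theorem sharp_of_weight (hn : 2 ≤ n) {c : TensorVec n B} {d : B → ℝ}
    (hd : d ∈ Set.Icc (0 : B → ℝ) 1) (hc : sqNorm c = 1)
    (h : 1 ≤ ∑ x, ‖c x‖ ^ 2 * ∏ i, d (x i) + ∑ x, ‖c x‖ ^ 2 * ∏ i, (1 - d (x i)))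
    {x : Fin n → B} (hx : c x ≠ 0) : (∀ i, d (x i) = 0) ∨ ∀ i, d (x i) = 1 := by
  have h0 := fun k => hd.1 k
  have h1 := fun k => hd.2 k
  simp only [Pi.zero_apply, Pi.one_apply] at h0 h1
  have hle : ∀ y : Fin n → B, ∀ i j, i ≠ j → ∏ k, d (y k) + ∏ k, (1 - d (y k)) ≤
      d (y i) * d (y j) + (1 - d (y i)) * (1 - d (y j)) := fun y i j hij =>
    prod_add_prod_one_sub_le (f := fun k => d (y k)) (fun k => h0 _) (fun k => h1 _) hij
  have hle1 : ∀ a b : ℝ, 0 ≤ a → a ≤ 1 → 0 ≤ b → b ≤ 1 → a * b + (1 - a) * (1 - b) ≤ 1 := by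
    intro a b ha ha' hb hb'
    nlinarith [mul_nonneg ha (sub_nonneg.2 hb'), mul_nonneg hb (sub_nonneg.2 ha')]
  have hterm : ∀ y ∈ Finset.univ,
      0 ≤ ‖c y‖ ^ 2 * (1 - (∏ k, d (y k) + ∏ k, (1 - d (y k)))) := by
    intro y _
    have := hle y ⟨0, by omega⟩ ⟨1, by omega⟩ (by simp)
    have := hle1 _ _ (h0 (y ⟨0, by omega⟩)) (h1 _) (h0 (y ⟨1, by omega⟩)) (h1 _)
    have : 0 ≤ 1 - (∏ k, d (y k) + ∏ k, (1 - d (y k))) := by linarith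
    positivity
  -- The terms are nonnegative, while the norm and the weight bound make their sum at most `1 - 1`.
  have hsum : ∑ y, ‖c y‖ ^ 2 * (1 - (∏ k, d (y k) + ∏ k, (1 - d (y k)))) = 0 := by
    refine le_antisymm ?_ (Finset.sum_nonneg hterm)
    simp only [mul_sub, mul_add, mul_one, Finset.sum_sub_distrib, Finset.sum_add_distrib]
    unfold sqNorm at hc
    linarith
  have hxz := (Finset.sum_eq_zero_iff_of_nonneg hterm).mp hsum x (Finset.mem_univ x)
  have hprod : ∏ k, d (x k) + ∏ k, (1 - d (x k)) = 1 := by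
    have := (mul_eq_zero.mp hxz).resolve_left (by simpa using hx)
    linarith
  -- With `a = d (x i)` and `b = d (x j)`, `1 - (ab + (1-a)(1-b)) = a(1-b) + b(1-a)` is a sum of
  -- nonnegative terms, and the pair bound makes it at most 0.
  have hpair : ∀ i j, i ≠ j → d (x i) * (1 - d (x j)) = 0 ∧ d (x j) * (1 - d (x i)) = 0 := by
    intro i j hij
    have h2 := hle x i j hij
    have ha := mul_nonneg (h0 (x i)) (sub_nonneg.2 (h1 (x j)))
    have hb := mul_nonneg (h0 (x j)) (sub_nonneg.2 (h1 (x i)))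
    constructor <;> nlinarith
  have hne : (⟨0, by omega⟩ : Fin n) ≠ ⟨1, by omega⟩ := by simp
  have h01 : d (x ⟨0, by omega⟩) = 0 ∨ d (x ⟨0, by omega⟩) = 1 := by
    obtain ⟨ha, hb⟩ := hpair _ _ hne
    rcases mul_eq_zero.mp ha with ha | ha
    · exact Or.inl ha
    · right
      rw [show d (x ⟨1, by omega⟩) = 1 by linarith] at hb
      linarith
  refine h01.imp (fun hz i => ?_) fun hz i => ?_ <;> by_cases hi : i = ⟨0, by omega⟩
  · rw [hi, hz]
  · have := (hpair _ _ hi).1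
    rw [hz] at this
    linarith
  · rw [hi, hz]
  · have := (hpair _ _ hi).2
    rw [hz] at this
    linarith

end Effects

/-! ### Recognizing the GHZ state -/

section Ghz

variable {n : ℕ}

theorem ghz_const (hn : 1 ≤ n) (k : Fin 2) :
    ghz n (fun _ => k) = 1 / ((Real.sqrt 2 : ℝ) : ℂ) := by
  have h : ∀ a b : Fin 2, ((fun _ : Fin n => a) = fun _ => b) ↔ a = b := fun a b =>
    ⟨fun h => congrFun h ⟨0, hn⟩, fun h => by rw [h]⟩
  unfold ghz
  simp only [h]
  fin_cases k <;> simp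

theorem ghz_eq_zero {x : Fin n → Fin 2} (hx : ∀ k, x ≠ fun _ => k) : ghz n x = 0 := by
  simp [ghz, hx]

theorem norm_sq_one_div_sqrt_two : ‖1 / ((Real.sqrt 2 : ℝ) : ℂ)‖ ^ 2 = 1 / 2 := by
  rw [norm_div, norm_one, Complex.norm_real, div_pow, Real.norm_eq_abs, sq_abs,
    Real.sq_sqrt (by norm_num), one_pow]

theorem ghz_comp_perm (σ : Equiv.Perm (Fin n)) (x : Fin n → Fin 2) :
    ghz n (x ∘ σ) = ghz n x := by
  have h : ∀ k : Fin 2, (x ∘ σ = fun _ => k) ↔ x = fun _ => k := by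
    intro k
    constructor
    · intro hx
      funext i
      simpa using congrFun hx (σ.symm i)
    · rintro rfl
      rfl
  simp [ghz, h]

/-- A vector supported on the two constant basis states with equal weights is the image of the GHZ
state under identical diagonal unitaries. -/
theorem exists_unitary_of_const_support (hn : 1 ≤ n) {c : TensorVec n (Fin 2)}
    (hsupp : ∀ x, (∀ k, x ≠ fun _ => k) → c x = 0)
    (hnorm : ∀ k, ‖c fun _ => k‖ ^ 2 = 1 / 2) :
    ∃ U ∈ Matrix.unitaryGroup (Fin 2) ℂ, c = tensorMap (fun _ => U) *ᵥ ghz n := by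
  -- The tensor power of `diag(z)` multiplies the constant string `k` by `z k ^ n`, so an `n`-th
  -- root of the required phase is needed.
  have hroot : ∀ k, ∃ z : ℂ, z ^ n = ((Real.sqrt 2 : ℝ) : ℂ) * c fun _ => k := fun k =>
    IsAlgClosed.exists_pow_nat_eq _ (by omega)
  choose z hz using hroot
  have hz1 : ∀ k, ‖z k‖ = 1 := by
    intro k
    have h1 : (‖z k‖ ^ n) ^ 2 = 1 := by
      rw [← norm_pow, hz, norm_mul, mul_pow, hnorm, Complex.norm_real, Real.norm_eq_abs, sq_abs,
        Real.sq_sqrt (by norm_num)]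
      norm_num
    rw [← pow_mul] at h1
    exact (pow_eq_one_iff_of_nonneg (norm_nonneg _) (by omega)).mp h1
  refine ⟨Matrix.diagonal z, ?_, ?_⟩
  · rw [Matrix.mem_unitaryGroup_iff, Matrix.star_eq_conjTranspose, Matrix.diagonal_conjTranspose,
      Matrix.diagonal_mul_diagonal, ← Matrix.diagonal_one]
    congr 1
    funext k
    simp [Complex.mul_conj', hz1]
  · funext x
    rw [tensorMap_diagonal, Matrix.mulVec_diagonal]
    by_cases hx : ∀ k, x ≠ fun _ => k
    · rw [hsupp x hx, ghz_eq_zero hx, mul_zero]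
    · push Not at hx
      obtain ⟨k, rfl⟩ := hx
      have h2 : ((Real.sqrt 2 : ℝ) : ℂ) ≠ 0 := by simp
      rw [ghz_const hn, Finset.prod_const, Finset.card_univ, Fintype.card_fin, hz]
      field_simp

theorem exists_unitary_of_tensorMap_conjTranspose {ψ : TensorVec n (Fin 2)}
    {W : Matrix (Fin 2) (Fin 2) ℂ} (hW : W ∈ Matrix.unitaryGroup (Fin 2) ℂ)
    (h : ∃ U ∈ Matrix.unitaryGroup (Fin 2) ℂ,
      tensorMap (fun _ => Wᴴ) *ᵥ ψ = tensorMap (fun _ => U) *ᵥ ghz n) :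
    ∃ U ∈ Matrix.unitaryGroup (Fin 2) ℂ, ψ = tensorMap (fun _ => U) *ᵥ ghz n := by
  obtain ⟨U, hU, h⟩ := h
  refine ⟨W * U, mul_mem hW hU, ?_⟩
  have h1 : W * Wᴴ = 1 := (Matrix.mem_unitaryGroup_iff).mp hW
  rw [← tensorMap_mul, ← Matrix.mulVec_mulVec, ← h, Matrix.mulVec_mulVec, tensorMap_mul, h1,
    tensorMap_one, Matrix.one_mulVec]

/-- A state of at least two qubits on which product effects of `d` and of `1 - d` both have weight
one half is the image of the GHZ state under identical unitaries. -/
theorem exists_unitary_of_weights (hn : 2 ≤ n) {c : TensorVec n (Fin 2)} {d : Fin 2 → ℝ}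
    (hd : d ∈ Set.Icc (0 : Fin 2 → ℝ) 1) (hc : sqNorm c = 1)
    (h0 : ∑ x, ‖c x‖ ^ 2 * ∏ i, d (x i) = 1 / 2)
    (h1 : 1 / 2 ≤ ∑ x, ‖c x‖ ^ 2 * ∏ i, (1 - d (x i))) :
    ∃ U ∈ Matrix.unitaryGroup (Fin 2) ℂ, c = tensorMap (fun _ => U) *ᵥ ghz n := by
  have hsharp : ∀ x, c x ≠ 0 → (∀ i, d (x i) = 0) ∨ ∀ i, d (x i) = 1 := fun x hx =>
    sharp_of_weight hn hd hc (by linarith) hx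
  have hne : n ≠ 0 := by omega
  let i₀ : Fin n := ⟨0, by omega⟩
  -- A nonvanishing term comes from a string in the support, and its values of `d` cannot all be 0.
  -- The dual argument with `1 - d` gives `hk0`.
  have hk1 : ∃ k, d k = 1 := by
    obtain ⟨x, -, hx⟩ := Finset.exists_ne_zero_of_sum_ne_zero
      (show ∑ x, ‖c x‖ ^ 2 * ∏ i, d (x i) ≠ 0 by rw [h0]; norm_num)
    refine ⟨x i₀, ?_⟩
    rcases hsharp x (fun h => hx (by simp [h])) with h | h
    · exact absurd (by simp [h, hne]) hx
    · exact h _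
  have hk0 : ∃ k, d k = 0 := by
    obtain ⟨x, -, hx⟩ := Finset.exists_ne_zero_of_sum_ne_zero
      (show ∑ x, ‖c x‖ ^ 2 * ∏ i, (1 - d (x i)) ≠ 0 by intro h; rw [h] at h1; norm_num at h1)
    refine ⟨x i₀, ?_⟩
    rcases hsharp x (fun h => hx (by simp [h])) with h | h
    · exact h _
    · exact absurd (by simp [h, hne]) hx
  obtain ⟨k0, hk0⟩ := hk0
  obtain ⟨k1, hk1⟩ := hk1
  have hk : k0 ≠ k1 := by
    rintro rfl
    linarith
  have hcases : ∀ k : Fin 2, k = k0 ∨ k = k1 := by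
    intro k
    omega
  have hconst : (fun _ : Fin n => k0) ≠ fun _ => k1 := fun h => hk (congrFun h i₀)
  have hd0 : ∀ k, d k = 0 → k = k0 := fun k h => (hcases k).resolve_right fun hk => by
    rw [hk, hk1] at h
    norm_num at h
  have hd1 : ∀ k, d k = 1 → k = k1 := fun k h => (hcases k).resolve_left fun hk => by
    rw [hk, hk0] at h
    norm_num at h
  have hsupp : ∀ x, x ≠ (fun _ => k0) ∧ x ≠ (fun _ => k1) → c x = 0 := by
    rintro x ⟨hx0, hx1⟩
    by_contra hx
    rcases hsharp x hx with h | h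
    · exact hx0 (funext fun i => hd0 _ (h i))
    · exact hx1 (funext fun i => hd1 _ (h i))
  have hw1 : ‖c fun _ => k1‖ ^ 2 = 1 / 2 := by
    rw [Fintype.sum_eq_add (fun _ => k0) (fun _ => k1) hconst
      fun x hx => by simp [hsupp x hx]] at h0
    simpa [hk0, hk1, hne] using h0
  have hw0 : ‖c fun _ => k0‖ ^ 2 = 1 / 2 := by
    unfold sqNorm at hc
    rw [Fintype.sum_eq_add (fun _ => k0) (fun _ => k1) hconst
      fun x hx => by simp [hsupp x hx]] at hc
    linarith
  refine exists_unitary_of_const_support (by omega) (fun x hx => hsupp x ⟨hx _, hx _⟩) fun k => ?_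
  rcases hcases k with rfl | rfl
  · exact hw0
  · exact hw1

/-- Every state of a single qubit is the image of the GHZ state under a unitary. -/
theorem exists_unitary_of_single {ψ : TensorVec 1 (Fin 2)} (hψ : sqNorm ψ = 1) :
    ∃ U ∈ Matrix.unitaryGroup (Fin 2) ℂ, ψ = tensorMap (fun _ => U) *ᵥ ghz 1 := by
  have hs : 1 / ((Real.sqrt 2 : ℝ) : ℂ) * (1 / ((Real.sqrt 2 : ℝ) : ℂ)) = 1 / 2 := by
    rw [div_mul_div_comm, ← Complex.ofReal_mul, Real.mul_self_sqrt (by norm_num)]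
    norm_num
  have hs' : star (1 / ((Real.sqrt 2 : ℝ) : ℂ)) = 1 / ((Real.sqrt 2 : ℝ) : ℂ) := by simp
  have hghz := ghz_const (n := 1) le_rfl
  generalize 1 / ((Real.sqrt 2 : ℝ) : ℂ) = s at hs hs' hghz
  have sum_single : ∀ f : (Fin 1 → Fin 2) → ℂ,
      ∑ x, f x = f (fun _ => 0) + f fun _ => 1 := by
    intro f
    rw [← (Equiv.funUnique (Fin 1) (Fin 2)).symm.sum_comp, Fin.sum_univ_two]
    rfl
  generalize ha : ψ (fun _ => 0) = a
  generalize hb : ψ (fun _ => 1) = b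
  have hnorm : star a * a + star b * b = 1 := by
    have := sqNorm_eq_dotProduct ψ
    rw [hψ, dotProduct, sum_single] at this
    simpa [ha, hb] using this.symm
  -- The Hadamard matrix, taking `ghz 1` to `|0⟩`, followed by the unitary with columns `(a, b)` and
  -- `(-star b, star a)`, taking `|0⟩` to `ψ`.
  refine ⟨!![s * (a - star b), s * (a + star b); s * (b + star a), s * (b - star a)], ?_, ?_⟩
  · rw [Matrix.mem_unitaryGroup_iff]
    ext i j
    fin_cases i <;> fin_cases j <;>
      simp only [Matrix.mul_apply, Fin.sum_univ_two, Matrix.star_apply, Matrix.of_apply,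
        Matrix.cons_val', Matrix.cons_val_zero, Matrix.cons_val_one, Matrix.cons_val_fin_one,
        Fin.zero_eta, Fin.mk_one, Fin.isValue, star_mul', star_sub, star_add, star_star, hs',
        Matrix.one_apply_eq, Matrix.one_apply_ne, ne_eq, zero_ne_one, one_ne_zero,
        not_false_eq_true]
    · linear_combination 2 * (star a * a + star b * b) * hs + hnorm
    · ring
    · ring
    · linear_combination 2 * (star a * a + star b * b) * hs + hnorm
  · funext x
    have hx : x = fun _ => x 0 := funext fun i => by rw [Subsingleton.elim i 0]
    rw [hx]
    generalize x 0 = k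
    simp only [Matrix.mulVec, dotProduct, sum_single, hghz, tensorMap, Matrix.of_apply,
      Finset.univ_unique, Finset.prod_singleton]
    fin_cases k
    · simp [ha]
      linear_combination -2 * a * hs
    · simp [hb]
      linear_combination -2 * b * hs

end Ghz

/-! ### Purely quantum protocols act locally -/

/-- The isometry that adds `m` ancilla qubits in the state `|0⟩` to a qubit. -/
def ancillaEmbedding (m : ℕ) : Matrix (LocalBasis m) (Fin 2) ℂ :=
  Matrix.of fun b q => if b.1 = q ∧ b.2 = 0 then 1 else 0

theorem ancillaEmbedding_isometry (m : ℕ) :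
    (ancillaEmbedding m)ᴴ * ancillaEmbedding m = 1 := by
  ext p q
  rw [Matrix.mul_apply, Matrix.one_apply, Finset.sum_eq_single (p, 0)]
  · simp [ancillaEmbedding]
  · rintro ⟨b, c⟩ - h
    have : ¬(b = p ∧ c = 0) := fun ⟨h1, h2⟩ => h (by rw [h1, h2])
    simp [ancillaEmbedding, this]
  · simp

namespace Protocol

variable (P : Protocol) {n : ℕ}

theorem initial_vec (ψ : TensorVec n (Fin 2)) :
    (P.initial ψ).vec = tensorMap (fun _ => ancillaEmbedding P.m) *ᵥ ψ := by
  funext x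
  simp only [initial, Matrix.mulVec, dotProduct, tensorMap, Matrix.of_apply]
  rw [Finset.sum_eq_single (fun i => (x i).1)]
  · simp [ancillaEmbedding, mul_comm]
  · intro y _ hy
    obtain ⟨i, hi⟩ := Function.ne_iff.mp hy
    rw [Finset.prod_eq_zero (Finset.mem_univ i), zero_mul]
    simp [ancillaEmbedding, Ne.symm hi]
  · simp

/-- The classical state of a processor that starts in `s`, receives no messages and observes `h`. -/
def localState (s : P.S) (h : List P.Obs) : P.S := h.foldl (fun s o => (P.update s 0 o).1) s

/-- The operator by which a processor that starts in `s`, receives no messages and observes `h` acts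
on its quantum memory. -/
def localOp : P.S → List P.Obs → Matrix (LocalBasis P.m) (LocalBasis P.m) ℂ
  | _, [] => 1
  | s, o :: h => localOp (P.update s 0 o).1 h * P.kraus s 0 o

variable {P}

theorem PurelyQuantum.kraus_eq (hP : P.PurelyQuantum) (s : P.S) (r : Multiset P.M) (o : P.Obs) :
    P.kraus s r o = P.kraus s 0 o := by
  unfold kraus
  rw [hP.unitary_eq s r 0, hP.meas_eq s r 0]

theorem PurelyQuantum.update_eq (hP : P.PurelyQuantum) (s : P.S) (r : Multiset P.M) (o : P.Obs) :
    (P.update s r o).1 = (P.update s 0 o).1 := by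
  cases o with
  | none => rfl
  | some j => exact hP.post_eq s r 0 j

/-- Every received multiset may be replaced by the empty one, after which the evolution factorizes
over the processors. -/
theorem PurelyQuantum.foldl_step (hP : P.PurelyQuantum) (h : List (Fin n → P.Obs))
    (c : P.Config n) :
    (h.foldl Config.step c).state = (fun i => P.localState (c.state i) (h.map fun o => o i)) ∧
      (h.foldl Config.step c).vec =
        tensorMap (fun i => P.localOp (c.state i) (h.map fun o => o i)) *ᵥ c.vec := by
  induction h generalizing c with
  | nil => simp [localState, localOp, tensorMap_one]
  | cons o h ih =>
    rw [List.foldl_cons, (ih _).1, (ih _).2]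
    constructor
    · funext i
      simp only [Config.step, hP.update_eq, List.map_cons, localState, List.foldl_cons]
    · simp only [Config.step, hP.update_eq, hP.kraus_eq, List.map_cons, localOp,
        tensorOp_eq_tensorMap]
      rw [Matrix.mulVec_mulVec, tensorMap_mul]

variable (P)

/-- The operator by which a processor that observes `h` acts on its initial qubit. -/
def qubitOp (h : List P.Obs) : Matrix (LocalBasis P.m) (Fin 2) ℂ :=
  P.localOp P.init h * ancillaEmbedding P.m

variable {P}

theorem PurelyQuantum.run_state (hP : P.PurelyQuantum) (ψ : TensorVec n (Fin 2))
    (h : List (Fin n → P.Obs)) :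
    (P.run ψ h).state = fun i => P.localState P.init (h.map fun o => o i) :=
  (hP.foldl_step h _).1

theorem PurelyQuantum.run_vec (hP : P.PurelyQuantum) (ψ : TensorVec n (Fin 2))
    (h : List (Fin n → P.Obs)) :
    (P.run ψ h).vec = tensorMap (fun i => P.qubitOp (h.map fun o => o i)) *ᵥ ψ := by
  have := (hP.foldl_step h (P.initial ψ)).2
  rw [P.initial_vec, Matrix.mulVec_mulVec, tensorMap_mul] at this
  exact this

variable (P)

theorem sum_kraus (s : P.S) (r : Multiset P.M) :
    ∑ o, (P.kraus s r o)ᴴ * P.kraus s r o = 1 := by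
  rw [Fintype.sum_option]
  unfold kraus
  cases P.result s with
  | some b => simp
  | none =>
    have hU : (P.unitary s r : Matrix (LocalBasis P.m) (LocalBasis P.m) ℂ)ᴴ *
        (P.unitary s r : Matrix (LocalBasis P.m) (LocalBasis P.m) ℂ) = 1 := by
      rw [← Matrix.star_eq_conjTranspose]
      exact (Matrix.mem_unitaryGroup_iff').mp (P.unitary s r).2
    have hj : ∀ j, ((P.meas s r).proj j * (P.unitary s r : Matrix _ _ ℂ))ᴴ *
        ((P.meas s r).proj j * (P.unitary s r : Matrix _ _ ℂ)) =
        (P.unitary s r : Matrix _ _ ℂ)ᴴ * (P.meas s r).proj j *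
          (P.unitary s r : Matrix _ _ ℂ) := by
      intro j
      have hpp := (P.meas s r).mul_proj j j
      rw [if_pos rfl] at hpp
      rw [Matrix.conjTranspose_mul, ((P.meas s r).isHermitian j).eq]
      calc _ = (P.unitary s r : Matrix _ _ ℂ)ᴴ * ((P.meas s r).proj j * (P.meas s r).proj j) *
            (P.unitary s r : Matrix _ _ ℂ) := by simp only [mul_assoc]
        _ = _ := by rw [hpp]
    simp only [hj, Matrix.conjTranspose_zero, zero_mul, zero_add]
    rw [← Finset.sum_mul, ← Finset.mul_sum, (P.meas s r).sum_proj, mul_one, hU]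

/-- Splitting off the first observation, the sum over the remaining history collapses to 1 by
induction, leaving the completeness relation of one round. -/
theorem sum_localOp (t : ℕ) (s : P.S) :
    ∑ h : Fin t → P.Obs, (P.localOp s (List.ofFn h))ᴴ * P.localOp s (List.ofFn h) = 1 := by
  induction t generalizing s with
  | zero => simp [localOp]
  | succ t ih =>
    rw [← (Fin.consEquiv fun _ => P.Obs).sum_comp, Fintype.sum_prod_type]
    rw [← P.sum_kraus s 0]
    refine Finset.sum_congr rfl fun o _ => ?_
    have : ∀ h : Fin t → P.Obs,
        (P.localOp s (List.ofFn (Fin.consEquiv (fun _ => P.Obs) (o, h))))ᴴ *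
          P.localOp s (List.ofFn (Fin.consEquiv (fun _ => P.Obs) (o, h))) =
        (P.kraus s 0 o)ᴴ * ((P.localOp (P.update s 0 o).1 (List.ofFn h))ᴴ *
          P.localOp (P.update s 0 o).1 (List.ofFn h)) * P.kraus s 0 o := by
      intro h
      simp [Fin.consEquiv, List.ofFn_succ, localOp, mul_assoc]
    simp only [this]
    rw [← Finset.sum_mul, ← Finset.mul_sum, ih, mul_one]

theorem sum_qubitOp (t : ℕ) :
    ∑ h : Fin t → P.Obs, (P.qubitOp (List.ofFn h))ᴴ * P.qubitOp (List.ofFn h) = 1 := by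
  have : ∀ h : List P.Obs, (P.qubitOp h)ᴴ * P.qubitOp h = (ancillaEmbedding P.m)ᴴ *
      ((P.localOp P.init h)ᴴ * P.localOp P.init h) * ancillaEmbedding P.m := by
    intro h
    simp [qubitOp, Matrix.conjTranspose_mul, Matrix.mul_assoc]
  simp only [this]
  rw [← Matrix.sum_mul, ← Matrix.mul_sum, P.sum_localOp, Matrix.mul_one,
    ancillaEmbedding_isometry]

open Classical in
/-- The effect on a processor's qubit of observing, in the first `t` rounds, a history in `p`. -/
noncomputable def effect (t : ℕ) (p : (Fin t → P.Obs) → Prop) : Matrix (Fin 2) (Fin 2) ℂ :=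
  ∑ h, if p h then (P.qubitOp (List.ofFn h))ᴴ * P.qubitOp (List.ofFn h) else 0

open scoped ComplexOrder in
theorem posSemidef_effect (t : ℕ) (p : (Fin t → P.Obs) → Prop) : (P.effect t p).PosSemidef := by
  refine Matrix.posSemidef_sum _ fun h _ => ?_
  split_ifs
  · exact Matrix.posSemidef_conjTranspose_mul_self _
  · exact Matrix.PosSemidef.zero

theorem one_sub_effect (t : ℕ) (p : (Fin t → P.Obs) → Prop) :
    1 - P.effect t p = P.effect t fun h => ¬p h := by
  rw [sub_eq_iff_eq_add, ← P.sum_qubitOp t, effect, effect, ← Finset.sum_add_distrib]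
  refine Finset.sum_congr rfl fun h _ => ?_
  by_cases hp : p h <;> simp [hp]

/-- A processor that observes `h` has terminated with the value `b`. -/
def Returns (b : Fin 2) {t : ℕ} (h : Fin t → P.Obs) : Prop :=
  P.result (P.localState P.init (List.ofFn h)) = some b

open Classical in
theorem re_tensorForm_effect (ψ : TensorVec n (Fin 2)) (t : ℕ) (p : (Fin t → P.Obs) → Prop) :
    (tensorForm ψ (P.effect t p)).re = ∑ g : Fin n → Fin t → P.Obs,
      if ∀ i, p (g i) then sqNorm (tensorMap (fun i => P.qubitOp (List.ofFn (g i))) *ᵥ ψ)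
      else 0 := by
  rw [effect, ← sum_sqNorm_tensorMap (fun h : Fin t → P.Obs => P.qubitOp (List.ofFn h)) p,
    Complex.ofReal_re]

variable {P}

theorem PurelyQuantum.probAgree_eq (hP : P.PurelyQuantum) (ψ : TensorVec n (Fin 2)) (b : Fin 2)
    (t : ℕ) : P.probAgree ψ b t = (tensorForm ψ (P.effect t (P.Returns b))).re := by
  classical
  -- A sequence of joint observations is regrouped as one history per processor.
  rw [re_tensorForm_effect, probAgree, ← (Equiv.piComm fun _ _ => P.Obs).sum_comp]
  refine Finset.sum_congr rfl fun g _ => ?_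
  have hagree : (P.run ψ (List.ofFn (Equiv.piComm (fun _ _ => P.Obs) g))).Agree b ↔
      ∀ i, P.Returns b (g i) := by
    simp only [Config.Agree, hP.run_state, List.map_ofFn, Returns]
    rfl
  simp only [hagree, hP.run_vec, List.map_ofFn]
  rfl

/-- A processor that has returned `1` has not returned `0`. This is only an inequality, as the
complementary effect also counts processors still running. -/
theorem PurelyQuantum.probAgree_le (hP : P.PurelyQuantum) (ψ : TensorVec n (Fin 2)) (t : ℕ) :
    P.probAgree ψ 1 t ≤ (tensorForm ψ (1 - P.effect t (P.Returns 0))).re := by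
  classical
  rw [hP.probAgree_eq, one_sub_effect, re_tensorForm_effect, re_tensorForm_effect]
  refine Finset.sum_le_sum fun g _ => ?_
  split_ifs with h1 h2
  · exact le_rfl
  · refine absurd (fun i h0 => ?_) h2
    exact absurd ((h1 i).symm.trans h0) (by simp)
  · exact sqNorm_nonneg _
  · exact le_rfl

end Protocol

/-! ### Measuring once and terminating with the result -/

/-- The weights of the projector onto the basis state `j` of a qubit. -/
def basisIndicator (j q : Fin 2) : ℝ := if q = j then 1 else 0

namespace Protocol

/-- After termination every observation other than `none` has operator 0, and `none` changes
nothing. -/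
theorem localState_of_result (P : Protocol) {s : P.S} {b : Fin 2} (hs : P.result s = some b)
    {h : List P.Obs} (hh : P.localOp s h ≠ 0) :
    h = List.replicate h.length none ∧ P.localOp s h = 1 ∧ P.localState s h = s := by
  induction h with
  | nil => simp [localOp, localState]
  | cons o h ih =>
    cases o with
    | some j => simp [localOp, kraus, hs] at hh
    | none =>
      have hk : P.localOp s (none :: h) = P.localOp s h := by
        simp [localOp, kraus, hs, update]
      rw [hk] at hh ⊢
      obtain ⟨h1, h2, h3⟩ := ih hh
      refine ⟨?_, h2, ?_⟩
      · rw [List.length_cons, List.replicate_succ, ← h1]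
      · exact h3

theorem localOp_replicate_none (P : Protocol) {s : P.S} {b : Fin 2} (hs : P.result s = some b)
    (k : ℕ) : P.localOp s (List.replicate k none) = 1 ∧
      P.localState s (List.replicate k none) = s := by
  induction k with
  | zero => simp [localOp, localState]
  | succ k ih =>
    rw [List.replicate_succ]
    exact ⟨by simp [localOp, kraus, hs, update, ih.1], ih.2⟩

/-- In the first round, every processor applies `V` to its qubit, measures it in the computational
basis and terminates with the result. -/
structure MeasuresOnce (P : Protocol) (V : Matrix (Fin 2) (Fin 2) ℂ) (out : Fin P.J ≃ Fin 2) :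
    Prop where
  purelyQuantum : P.PurelyQuantum
  result_init : P.result P.init = none
  result_post : ∀ j, P.result (P.post P.init 0 j).1 = some (out j)
  kraus_mul : ∀ j, P.kraus P.init 0 (some j) * ancillaEmbedding P.m =
    ancillaEmbedding P.m * (Matrix.diagonal (fun q => (basisIndicator (out j) q : ℂ)) * V)

namespace MeasuresOnce

variable {P : Protocol} {V : Matrix (Fin 2) (Fin 2) ℂ} {out : Fin P.J ≃ Fin 2} {n : ℕ}

theorem qubitOp_cons (hP : P.MeasuresOnce V out) (j : Fin P.J) {h : List P.Obs}
    (hh : P.localOp (P.post P.init 0 j).1 h = 1) :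
    P.qubitOp (some j :: h) =
      ancillaEmbedding P.m * (Matrix.diagonal (fun q => (basisIndicator (out j) q : ℂ)) * V) := by
  rw [← hP.kraus_mul]
  simp [qubitOp, localOp, update, hh]

theorem of_qubitOp_ne_zero (hP : P.MeasuresOnce V out) {o : P.Obs} {h : List P.Obs}
    (hh : P.qubitOp (o :: h) ≠ 0) :
    ∃ j, o = some j ∧ h = List.replicate h.length none ∧
      P.result (P.localState P.init (o :: h)) = some (out j) ∧
      P.qubitOp (o :: h) = ancillaEmbedding P.m *
        (Matrix.diagonal (fun q => (basisIndicator (out j) q : ℂ)) * V) := by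
  cases o with
  | none => simp [qubitOp, localOp, kraus, hP.result_init] at hh
  | some j =>
    have hop : P.localOp (P.post P.init 0 j).1 h ≠ 0 := by
      intro h0
      simp [qubitOp, localOp, update, h0] at hh
    obtain ⟨h1, h2, h3⟩ := P.localState_of_result (hP.result_post j) hop
    refine ⟨j, rfl, h1, ?_, hP.qubitOp_cons j h2⟩
    rw [← hP.result_post j, ← h3]
    rfl

theorem terminating (hP : P.MeasuresOnce V out) (ψ : TensorVec n (Fin 2)) : P.Terminating ψ := by
  intro ω hω
  refine ⟨1, fun i => ?_⟩
  have h1 := hω 1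
  rw [hP.purelyQuantum.run_vec] at h1
  have hi : P.qubitOp [ω 0 i] ≠ 0 := fun h0 =>
    h1 (by rw [tensorMap_eq_zero (i := i) h0, Matrix.zero_mulVec])
  obtain ⟨j, -, -, hj, -⟩ := hP.of_qubitOp_ne_zero hi
  rw [hP.purelyQuantum.run_state]
  change (P.result (P.localState P.init [ω 0 i])).isSome
  rw [hj]
  rfl

theorem agree (hP : P.MeasuresOnce V out) (hn : 1 ≤ n) {ψ : TensorVec n (Fin 2)}
    (hψ : tensorMap (fun _ => V) *ᵥ ψ = ghz n) (h : List (Fin n → P.Obs))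
    (hv : (P.run ψ h).vec ≠ 0) (ht : (P.run ψ h).IsTerminal) : ∃ b, (P.run ψ h).Agree b := by
  cases h with
  | nil =>
    have h0 : (P.result P.init).isSome := ht ⟨0, hn⟩
    rw [hP.result_init] at h0
    simp at h0
  | cons o h =>
    rw [hP.purelyQuantum.run_vec] at hv
    have hi : ∀ i, P.qubitOp (o i :: h.map fun o => o i) ≠ 0 :=
      fun i h0 => hv (by rw [tensorMap_eq_zero (i := i) h0, Matrix.zero_mulVec])
    choose j _ _ hj hop using fun i => hP.of_qubitOp_ne_zero (hi i)
    have hvec : tensorMap (fun i => P.qubitOp ((o :: h).map fun o => o i)) *ᵥ ψ =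
        tensorMap (fun _ => ancillaEmbedding P.m) *ᵥ
          fun x => (∏ i, (basisIndicator (out (j i)) (x i) : ℂ)) * ghz n x := by
      simp only [List.map_cons, hop]
      rw [← tensorMap_mul, ← Matrix.mulVec_mulVec, ← tensorMap_mul, ← Matrix.mulVec_mulVec, hψ,
        tensorMap_diagonal]
      congr 1
      funext x
      rw [Matrix.mulVec_diagonal]
    -- The projectors keep only the coordinate of `ghz n` at the string of outcomes, which is 0
    -- unless that string is constant.
    have hconst : ∃ k, (fun i => out (j i)) = fun _ => k := by
      by_contra! hk
      have hz : (fun x => (∏ i, (basisIndicator (out (j i)) (x i) : ℂ)) * ghz n x) = 0 := by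
        funext x
        by_cases hx : x = fun i => out (j i)
        · rw [hx, ghz_eq_zero hk, mul_zero, Pi.zero_apply]
        · obtain ⟨i, hxi⟩ := Function.ne_iff.mp hx
          rw [Finset.prod_eq_zero (Finset.mem_univ i), zero_mul, Pi.zero_apply]
          simp [basisIndicator, hxi]
      exact hv (by rw [hvec, hz, Matrix.mulVec_zero])
    obtain ⟨k, hk⟩ := hconst
    refine ⟨k, fun i => ?_⟩
    rw [hP.purelyQuantum.run_state, ← congrFun hk i]
    exact hj i

theorem effect_returns (hP : P.MeasuresOnce V out) (b : Fin 2) (t : ℕ) :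
    P.effect (t + 1) (P.Returns b) =
      Vᴴ * Matrix.diagonal (fun q => (basisIndicator b q : ℂ)) * V := by
  classical
  obtain ⟨j, rfl⟩ := out.surjective b
  -- The only history with nonzero operator that returns `out j`: one measurement, then idling.
  let g : Fin (t + 1) → P.Obs := Fin.cons (some j) fun _ => none
  have hg : List.ofFn g = some j :: List.replicate t none := by
    rw [List.ofFn_succ, ← List.ofFn_const]
    rfl
  have hrep := P.localOp_replicate_none (hP.result_post j) t
  unfold Protocol.effect
  rw [Finset.sum_eq_single g]
  · rw [if_pos]
    · rw [hg, hP.qubitOp_cons j hrep.1, Matrix.conjTranspose_mul,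
        Matrix.mul_assoc, ← Matrix.mul_assoc _ (ancillaEmbedding P.m), ancillaEmbedding_isometry,
        Matrix.one_mul, Matrix.conjTranspose_mul, Matrix.diagonal_conjTranspose, mul_assoc,
        ← mul_assoc (Matrix.diagonal _), Matrix.diagonal_mul_diagonal, mul_assoc]
      congr 3
      funext q
      by_cases hq : q = out j <;> simp [basisIndicator, hq]
    · unfold Protocol.Returns
      rw [hg, ← hP.result_post j, ← hrep.2]
      rfl
  · intro f _ hf
    split_ifs with hr
    · by_cases h0 : P.qubitOp (List.ofFn f) = 0
      · rw [h0, Matrix.mul_zero]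
      · refine absurd ?_ hf
        unfold Protocol.Returns at hr
        rw [List.ofFn_succ] at h0 hr
        obtain ⟨j', hj, htail, hst, -⟩ := hP.of_qubitOp_ne_zero h0
        rw [hst] at hr
        have hjj : j' = j := out.injective (Option.some.inj hr)
        rw [hjj] at hj
        apply List.ofFn_injective
        rw [hg, List.ofFn_succ, hj, htail, List.length_ofFn]
    · rfl
  · simp

theorem totallyCorrect (hP : P.MeasuresOnce V out) (hn : 1 ≤ n) {ψ : TensorVec n (Fin 2)}
    (hψ : tensorMap (fun _ => V) *ᵥ ψ = ghz n) : P.TotallyCorrect ψ := by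
  refine ⟨hP.terminating ψ, hP.agree hn hψ, fun b => ?_⟩
  -- Before the first round nobody has terminated; from round 1 on the probability is constantly
  -- 1/2.
  rw [← Filter.tendsto_add_atTop_iff_nat 1]
  refine tendsto_const_nhds.congr fun t => ?_
  rw [hP.purelyQuantum.probAgree_eq, hP.effect_returns]
  have := tensorForm_conj ψ Vᴴ (Matrix.diagonal (fun q => (basisIndicator b q : ℂ)))
  rw [Matrix.conjTranspose_conjTranspose] at this
  rw [this, hψ, tensorForm_diagonal, Complex.ofReal_re, Finset.sum_eq_single fun _ => b]
  · rw [ghz_const hn, norm_sq_one_div_sqrt_two]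
    simp [basisIndicator]
  · intro x _ hx
    obtain ⟨i, hxi⟩ := Function.ne_iff.mp hx
    rw [Finset.prod_eq_zero (Finset.mem_univ i), mul_zero]
    simp [basisIndicator, hxi]
  · simp

end MeasuresOnce

end Protocol

/-! ### Measuring in a rotated basis -/

/-- A unitary on a qubit, as a unitary on a quantum memory without ancillas. -/
def qubitUnitary (V : Matrix.unitaryGroup (Fin 2) ℂ) : Matrix.unitaryGroup (LocalBasis 0) ℂ :=
  ⟨(V : Matrix (Fin 2) (Fin 2) ℂ).submatrix (Equiv.prodUnique _ _) (Equiv.prodUnique _ _), by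
    rw [Matrix.mem_unitaryGroup_iff, Matrix.star_eq_conjTranspose, Matrix.conjTranspose_submatrix,
      Matrix.submatrix_mul_equiv, ← Matrix.star_eq_conjTranspose,
      (Matrix.mem_unitaryGroup_iff).mp V.2, Matrix.submatrix_one_equiv]⟩

/-- Every processor applies `V` to its qubit, measures it in the computational basis and terminates
with the result. -/
def rotatedMeasureProtocol (V : Matrix.unitaryGroup (Fin 2) ℂ) : Protocol :=
  { measureProtocol with unitary := fun _ _ => qubitUnitary V }

theorem rotatedMeasureProtocol_one : rotatedMeasureProtocol 1 = measureProtocol := by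
  have : qubitUnitary 1 = 1 := by
    ext x y
    exact congrFun (congrFun (Matrix.submatrix_one_equiv
      (Equiv.prodUnique (Fin 2) (Fin 0 → Fin 2))) x) y
  unfold rotatedMeasureProtocol
  rw [this]
  rfl

theorem projector_mul_qubitUnitary_mul_ancillaEmbedding (V : Matrix.unitaryGroup (Fin 2) ℂ)
    (j : Fin 2) : measureQubit.proj j * (qubitUnitary V : Matrix _ _ ℂ) * ancillaEmbedding 0 =
      ancillaEmbedding 0 * (Matrix.diagonal (fun q => (basisIndicator j q : ℂ)) *
        (V : Matrix (Fin 2) (Fin 2) ℂ)) := by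
  have hl : ∀ M : Matrix (LocalBasis 0) (LocalBasis 0) ℂ, ∀ x q,
      (M * ancillaEmbedding 0) x q = M x (q, 0) := by
    intro M x q
    rw [Matrix.mul_apply, Finset.sum_eq_single (q, 0)]
    · simp [ancillaEmbedding]
    · rintro ⟨b, c⟩ - h
      have : b ≠ q := fun h1 => h (Prod.ext h1 (Subsingleton.elim _ _))
      simp [ancillaEmbedding, this]
    · simp
  have hr : ∀ M : Matrix (Fin 2) (Fin 2) ℂ, ∀ x q,
      (ancillaEmbedding 0 * M) x q = M x.1 q := by
    intro M x q
    rw [Matrix.mul_apply, Finset.sum_eq_single x.1]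
    · simp [ancillaEmbedding, Subsingleton.elim x.2 0]
    · intro b _ h
      simp [ancillaEmbedding, Ne.symm h]
    · simp
  ext x q
  rw [hl, hr, Matrix.diagonal_mul]
  by_cases hx : x.1 = j <;>
    simp [measureQubit, qubitUnitary, Matrix.diagonal_mul, basisIndicator, hx]

theorem rotatedMeasureProtocol_measuresOnce (V : Matrix.unitaryGroup (Fin 2) ℂ) :
    (rotatedMeasureProtocol V).MeasuresOnce V (Equiv.refl (Fin 2)) where
  purelyQuantum :=
    { unitary_eq := fun _ _ _ => rfl
      meas_eq := fun _ _ _ => rfl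
      post_eq := fun _ _ _ _ => rfl
      result_eq := fun _ _ _ _ _ h => congrArg Fin.val (Option.some.inj h) }
  result_init := rfl
  result_post _ := rfl
  kraus_mul j := projector_mul_qubitUnitary_mul_ancillaEmbedding V j

/-! ### The characterization -/

/-- Identical local operators commute with permutations of the qubits, so here even the vector is
invariant, without a phase. -/
theorem isAnonymous_of_ghz {n : ℕ} (U : Matrix (Fin 2) (Fin 2) ℂ) :
    IsAnonymous (tensorMap (fun _ : Fin n => U) *ᵥ ghz n) := by
  intro σ
  have h : ∀ x, (tensorMap (fun _ : Fin n => U) *ᵥ ghz n) (x ∘ σ) =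
      (tensorMap (fun _ : Fin n => U) *ᵥ ghz n) x := by
    intro x
    simp only [Matrix.mulVec, dotProduct]
    rw [← (σ.symm.arrowCongr (Equiv.refl (Fin 2))).sum_comp]
    refine Finset.sum_congr rfl fun y _ => ?_
    have hy : σ.symm.arrowCongr (Equiv.refl (Fin 2)) y = y ∘ σ := rfl
    rw [hy, ghz_comp_perm]
    congr 1
    exact Equiv.prod_comp σ fun i => U (x i) (y i)
  ext x y
  simp only [density, Matrix.submatrix_apply, Matrix.of_apply, h]

theorem Protocol.PurelyQuantum.exists_unitary {n : ℕ} (hn : 1 ≤ n) {ψ : TensorVec n (Fin 2)}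
    (hψ : sqNorm ψ = 1) {P : Protocol} (hP : P.PurelyQuantum)
    (hlim : ∀ b, Filter.Tendsto (P.probAgree ψ b) Filter.atTop (nhds (1 / 2))) :
    ∃ U ∈ Matrix.unitaryGroup (Fin 2) ℂ, ψ = tensorMap (fun _ => U) *ᵥ ghz n := by
  obtain rfl | hn := hn.eq_or_lt
  · exact exists_unitary_of_single hψ
  obtain ⟨W, hW, d, hd, h0, h1⟩ := exists_limit_effect ψ (fun t => P.effect t (P.Returns 0))
    (fun t => P.posSemidef_effect t _)
    (fun t => by rw [P.one_sub_effect]; exact P.posSemidef_effect t _)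
    ((hlim 0).congr fun t => hP.probAgree_eq ψ 0 t) (hlim 1) fun t => hP.probAgree_le ψ t
  refine exists_unitary_of_tensorMap_conjTranspose hW (exists_unitary_of_weights hn hd ?_ h0 h1)
  rw [sqNorm_unitary_mulVec ψ ((Matrix.mem_unitaryGroup_iff).mp hW), hψ]

/-- For `n ≥ 1` processors that own one qubit each of a shared pure state `ψ`: a totally correct
anonymous purely quantum distributed consensus protocol exists if and only if `ψ` is the GHZ state
up to identical local unitaries; and for the GHZ state itself it suffices that every processor
simply measures its qubit. -/
theorem theorem2 (n : ℕ) (hn : 1 ≤ n) :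
    (∀ ψ : TensorVec n (Fin 2), sqNorm ψ = 1 →
      ((IsAnonymous ψ ∧ ∃ P : Protocol, P.PurelyQuantum ∧ P.TotallyCorrect ψ) ↔
        ∃ U ∈ Matrix.unitaryGroup (Fin 2) ℂ, ψ = tensorOp (fun _ => U) *ᵥ ghz n)) ∧
    (measureProtocol.PurelyQuantum ∧ measureProtocol.TotallyCorrect (ghz n)) := by
  refine ⟨fun ψ hψ => ⟨?_, ?_⟩, ?_⟩
  · rintro ⟨-, P, hP, -, -, hlim⟩
    exact hP.exists_unitary hn hψ hlim
  · rintro ⟨U, hU, rfl⟩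
    refine ⟨isAnonymous_of_ghz U, rotatedMeasureProtocol (star ⟨U, hU⟩),
      (rotatedMeasureProtocol_measuresOnce _).purelyQuantum, (rotatedMeasureProtocol_measuresOnce _).totallyCorrect hn ?_⟩
    have hUU : star U * U = 1 := (Matrix.mem_unitaryGroup_iff').mp hU
    rw [tensorOp_eq_tensorMap, Matrix.mulVec_mulVec, tensorMap_mul]
    change tensorMap (fun _ => star U * U) *ᵥ ghz n = ghz n
    rw [hUU, tensorMap_one, Matrix.one_mulVec]
  · rw [← rotatedMeasureProtocol_one]
    refine ⟨(rotatedMeasureProtocol_measuresOnce _).purelyQuantum,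
      (rotatedMeasureProtocol_measuresOnce _).totallyCorrect hn ?_⟩
    change tensorMap (fun _ => (1 : Matrix (Fin 2) (Fin 2) ℂ)) *ᵥ ghz n = ghz n
    rw [tensorMap_one, Matrix.one_mulVec]
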